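/- Let $0\le m<n$ and $k\ge 1$ be integers, and write points of $\mathbb{R}^n=\mathbb{R}^m\times\mathbb{R}^{n-m}$ as $z=(a,b)$, with projections $\pi z=a$ and $\pi^\perp z=b$. Let $D\subset\mathbb{R}^n$ be open and bounded, let $g_0,\dots,g_k:D\to\mathbb{R}^n$ be of class $C^{k+1}$, let $\varepsilon_0>0$, and let $g:D\times(-\varepsilon_0,\varepsilon_0)\to\mathbb{R}^n$ be a function of class $C^{k+1}$ such that, for every $z\in D$, $$g(z,\varepsilon)=\sum_{i=0}^k\varepsilon^i g_i(z)+O(\varepsilon^{k+1})\quad(\varepsilon\to0).$$ Let $V\subset\mathbb{R}^m$ be open and bounded, with closure $\overline V$, and let $\beta:\overline V\to\mathbb{R}^{n-m}$ be of class $C^{k+1}$ and such that $z_\alpha:=(\alpha,\beta(\alpha))\in D$ for all $\alpha\in\overline V$. Assume (H$_a$) $g_0(z_\alpha)=0$ for all $\alpha\in\overline V$, and that $\Delta_\alpha:=\dfrac{\partial\,\pi^\perp g_0}{\partial b}(z_\alpha)$ satisfies $\det\Delta_\alpha\neq0$ for all $\alpha\in\overline V$. For integers $r,s\ge0$ let $S_{r,s}$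 be the set of $r$-tuples $c=(c_1,\dots,c_r)$ of non-negative integers with $c_1+2c_2+\dots+rc_r=s$ (so $S_{0,0}$ consists of the empty tuple and $S_{0,1}=\emptyset$). Put $|c|=c_1+\dots+c_r$. For a function $h$ of $z=(a,b)$ and vectors $v_1,\dots,v_r\in\mathbb{R}^{n-m}$ put $$B_{r,s}[h](z;v_1,\dots,v_r)=\sum_{c\in S_{r,s}}\frac{1}{\prod_{j=1}^r c_j!\,(j!)^{c_j}}\;\partial_b^{|c|}h(z)\bigl[\underbrace{v_1,\dots,v_1}_{c_1},\dots,\underbrace{v_r,\dots,v_r}_{c_r}\bigr],$$ where $\partial_b^{L}h(z)$ is the $L$-th Fréchet derivative of $h$ with respect to $b$, a symmetric $L$-linear map ($\partial_b^0h=h$). Define recursively, for $i=1,\dots,k$, $$\gamma_i(\alpha)=-i!\,\Delta_\alpha^{-1}\Bigl(B_{i-1,i}[\pi^\perp g_0](z_\alpha;\gamma_1(\alpha),\dots,\gamma_{i-1}(\alpha))+\sum_{l=0}^{i-1}B_{l,l}[\pi^\perp g_{i-l}](z_\alpha;\gamma_1(\alpha),\dots,\gamma_l(\alpha))\Bigr)\in\mathbb{R}^{n-m}$$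 (in particular $\gamma_1(\alpha)=-\Delta_\alpha^{-1}\pi^\perp g_1(z_\alpha)$), and the bifurcation functions $f_i:\overline V\to\mathbb{R}^m$ by $$f_i(\alpha)=\pi g_i(z_\alpha)+\sum_{l=1}^{i}B_{l,l}[\pi g_{i-l}](z_\alpha;\gamma_1(\alpha),\dots,\gamma_l(\alpha)),\qquad i=1,\dots,k.$$ Assume that $f_1=\dots=f_{k-1}=0$ on $\overline V$, and that there is $\alpha^*\in V$ with $f_k(\alpha^*)=0$ and $\det Df_k(\alpha^*)\neq0$. Then there is a continuous branch of zeros of $g$ bifurcating from $z_{\alpha^*}$: there exist $\varepsilon_1\in(0,\varepsilon_0]$ and a continuous function $z:(-\varepsilon_1,\varepsilon_1)\to D$ such that $g(z(\varepsilon),\varepsilon)=0$ for all $|\varepsilon|<\varepsilon_1$ and $$|z(\varepsilon)-z_{\alpha^*}|=O(\varepsilon)\quad(\varepsilon\to0).$$ -/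

import Mathlib

open Set Filter Topology Asymptotics

noncomputable section

namespace LyapunovSchmidt

/-- The set of all `r`-tuples `(c₁, …, c_r)` of non-negative integers with
`c₁ + 2 c₂ + ⋯ + r c_r = s` (the entry `c_j` is stored at the index `j - 1`).
The set `S_l` is `tuples l l`, and the set `S'_i` is `tuples (i - 1) i`. -/
def tuples (r s : ℕ) : Finset (Fin r → ℕ) :=
  (Fintype.piFinset fun _ : Fin r => Finset.range (s + 1)).filter
    fun c => ∑ j : Fin r, ((j : ℕ) + 1) * c j = s

/-- The bound on the entries in the definition of `tuples` excludes nothing. -/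
theorem mem_tuples {r s : ℕ} {c : Fin r → ℕ} :
    c ∈ tuples r s ↔ ∑ j : Fin r, ((j : ℕ) + 1) * c j = s := by
  unfold tuples
  rw [Finset.mem_filter, Fintype.mem_piFinset]
  refine ⟨fun h => h.2, fun h => ⟨fun j => ?_, h⟩⟩
  have h1 : ((j : ℕ) + 1) * c j ≤ s := by
    rw [← h]
    exact Finset.single_le_sum (f := fun j : Fin r => ((j : ℕ) + 1) * c j)
      (fun _ _ => Nat.zero_le _) (Finset.mem_univ j)
  rw [Finset.mem_range]
  nlinarith [Nat.zero_le ((j : ℕ) * c j)]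

/-- The coefficient `1 / (c₁! c₂! 2!^{c₂} ⋯ c_r! r!^{c_r})`. -/
def coeff {r : ℕ} (c : Fin r → ℕ) : ℝ :=
  1 / ∏ j : Fin r, ((c j).factorial * (((j : ℕ) + 1).factorial) ^ (c j) : ℝ)

variable {E F G : Type*} [NormedAddCommGroup E] [NormedSpace ℝ E]
  [NormedAddCommGroup F] [NormedSpace ℝ F] [NormedAddCommGroup G] [NormedSpace ℝ G]

/-- `∂^L h(b) ⨀_j v_j^{c_j}` with `L = c₁ + ⋯ + c_r`: the `L`-th Fréchet derivative of `h` at `b`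
applied to the `L` vectors `v₁, …, v₁, v₂, …, v₂, …`, where `v_j` occurs `c_j` times. -/
def derivProd (h : F → G) (b : F) {r : ℕ} (v : Fin r → F) (c : Fin r → ℕ) : G :=
  iteratedFDeriv ℝ (∑ j, c j) h b fun t => v (finSigmaFinEquiv.symm t).1

/-- The sum of `coeff c • ∂^L h(b) ⨀_j v_j^{c_j}` over all `r`-tuples `c` with
`c₁ + 2 c₂ + ⋯ + r c_r = s`. -/
def bellSum (h : F → G) (b : F) (r s : ℕ) (v : Fin r → F) : G :=
  ∑ c ∈ tuples r s, coeff c • derivProd h b v c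

/-- `Δ_α`, the derivative of `π^⊥ g₀` with respect to `b` at `z_α = (α, β(α))`. -/
def Delta (g₀ : E × F → E × F) (β : E → F) (α : E) : F →L[ℝ] F :=
  fderiv ℝ (fun b => (g₀ (α, b)).2) (β α)

/-- The functions `γ_i`, `i ≥ 1` (the value at `i = 0` is never used):
`γ_i(α) = - i! Δ_α⁻¹ (∑_{S'_i} … ∂_b^{I'} π^⊥ g₀(z_α) … +
  ∑_{l=0}^{i-1} ∑_{S_l} … ∂_b^L π^⊥ g_{i-l}(z_α) …)`. -/
def gam (g : ℕ → E × F → E × F) (β : E → F) : ℕ → E → F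
  | 0, _ => 0
  | i + 1, α =>
    -(((i + 1).factorial : ℝ) • (Delta (g 0) β α).inverse
      (bellSum (fun b => (g 0 (α, b)).2) (β α) i (i + 1)
          (fun j : Fin i => gam g β ((j : ℕ) + 1) α)
        + ∑ l : Fin (i + 1), bellSum (fun b => (g (i + 1 - l) (α, b)).2) (β α) l l
          (fun j : Fin (l : ℕ) => gam g β ((j : ℕ) + 1) α)))
  termination_by i => i
  decreasing_by all_goals omega

/-- The bifurcation function of order `i`:
`f_i(α) = π g_i(z_α) + ∑_{l=1}^{i} ∑_{S_l} … ∂_b^L π g_{i-l}(z_α) …`. -/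
def bifFun (g : ℕ → E × F → E × F) (β : E → F) (i : ℕ) (α : E) : E :=
  (g i (α, β α)).1 + ∑ l ∈ Finset.Icc 1 i,
    bellSum (fun b => (g (i - l) (α, b)).1) (β α) l l
      (fun j : Fin l => gam g β ((j : ℕ) + 1) α)

end LyapunovSchmidt

end

/-! Lyapunov–Schmidt reduction. Since `Δ_α` is invertible, the implicit function theorem solves `π^⊥
g(a, b, ε) = 0` near `z_{α*}` by a `C^{k+1}` function `b(a, ε)` with `b(a, 0) = β(a)`
(`exists_implicit_branch`). What remains is `δ(a, ε) = π g(a, b(a, ε), ε) = 0`.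

For fixed `a`, write `b(a, ε) = ∑ ε^i v_i + O(ε^{k+1})`. Taylor's formula and the multinomial
theorem give the coefficients of `∑ ε^i g_i(a, b(a, ε))` as Bell sums in the vectors `j! v_j`
(`sum_comp_expansion`). The `π^⊥` coefficients vanish, which is the recursion for `γ_i` and forces
`i! v_i = γ_i(a)`; the `π` coefficients are then the `f_i(a)` (`bifurcation_expansion`).

Near `α*` all coefficients of `δ` below order `k` therefore vanish, and Hadamard division gives `δ =
ε^k w` with `w` of class `C^1` and `w(·, 0) = f_k`. A simple zero of `f_k` continues to a zero
`A(ε)` of `w(·, ε)`, and the branch is `z(ε) = (A(ε), b(A(ε), ε))`. It is `C^1` at `0`, hence the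
bound `O(ε)`. -/

namespace LyapunovSchmidt

/-! ### Symmetry of higher derivatives and the multinomial formula. -/

section Symmetry

variable {F G : Type*} [NormedAddCommGroup F] [NormedSpace ℝ F]
  [NormedAddCommGroup G] [NormedSpace ℝ G]

/-- The iterated directional derivative of `h` along the vectors of a list. -/
noncomputable def dirDeriv (h : F → G) : List F → F → G
  | [] => h
  | a :: l => fun x => fderiv ℝ (dirDeriv h l) x a

theorem contDiffOn_dirDeriv {N : ℕ} {h : F → G} {U : Set F} (hU : IsOpen U)
    (hh : ContDiffOn ℝ N h U) (l : List F) :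
    ∀ n : ℕ, l.length + n ≤ N → ContDiffOn ℝ n (dirDeriv h l) U := by
  induction l with
  | nil => exact fun n hn => hh.of_le (by simpa using hn)
  | cons a l ih =>
    intro n hn
    have h1 := ih (n + 1) (by simp at hn; omega)
    exact (h1.fderiv_of_isOpen hU (m := n) (by simp)).clm_apply contDiffOn_const

/-- Adjacent swaps generate all permutations, and a swap is the symmetry of a second derivative. The
equality is kept on a whole open set so that it can be differentiated in the `cons` case. -/
theorem dirDeriv_perm {N : ℕ} {h : F → G} {U : Set F} (hU : IsOpen U)
    (hh : ContDiffOn ℝ N h U) {l₁ l₂ : List F} (hl : l₁.Perm l₂) (hN : l₁.length ≤ N) :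
    ∀ x ∈ U, dirDeriv h l₁ x = dirDeriv h l₂ x := by
  induction hl with
  | nil => exact fun _ _ => rfl
  | cons a _ ih =>
    intro x hx
    have h1 := ih (by simp at hN; omega)
    have h2 := Filter.EventuallyEq.fderiv_eq (𝕜 := ℝ)
      (Filter.eventually_of_mem (hU.mem_nhds hx) h1)
    exact congrArg (fun T => T a) h2
  | swap a b l =>
    intro x hx
    have h1 : ContDiffAt ℝ (2 : ℕ) (dirDeriv h l) x :=
      (contDiffOn_dirDeriv hU hh l 2 (by simp at hN; omega)).contDiffAt (hU.mem_nhds hx)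
    have h2 : DifferentiableAt ℝ (fderiv ℝ (dirDeriv h l)) x :=
      (h1.fderiv_right (m := 1) (by norm_num)).differentiableAt (by simp)
    have h3 : ∀ u v : F, dirDeriv h (u :: v :: l) x = fderiv ℝ (fderiv ℝ (dirDeriv h l)) x u v := by
      intro u v
      simp only [dirDeriv]
      rw [fderiv_clm_apply h2 (by fun_prop)]
      simp
    rw [h3, h3]
    exact h1.isSymmSndFDerivAt (by simp) _ _
  | trans h₁ _ ih₁ ih₂ =>
    intro x hx
    rw [ih₁ hN x hx, ih₂ (h₁.length_eq ▸ hN) x hx]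

theorem iteratedFDeriv_eq_dirDeriv {N : ℕ} {h : F → G} {U : Set F} (hU : IsOpen U)
    (hh : ContDiffOn ℝ N h U) : ∀ n : ℕ, n ≤ N → ∀ (v : Fin n → F), ∀ x ∈ U,
      iteratedFDeriv ℝ n h x v = dirDeriv h (List.ofFn v) x := by
  intro n
  induction n with
  | zero => intro _ v x _; simp [dirDeriv]
  | succ n ih =>
    intro hn v x hx
    have h1 : DifferentiableAt ℝ (iteratedFDeriv ℝ n h) x :=
      (hh.contDiffAt (hU.mem_nhds hx)).differentiableAt_iteratedFDeriv (by exact_mod_cast hn)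
    rw [h1.iteratedFDeriv_succ_apply_left', List.ofFn_succ]
    have h2 := Filter.EventuallyEq.fderiv_eq (𝕜 := ℝ) (Filter.eventually_of_mem (hU.mem_nhds hx)
      (ih (by omega) (fun i => v i.succ)))
    exact congrArg (fun T => T (v 0)) h2

/-- The value of the symmetric multilinear map `iteratedFDeriv ℝ s.card h x` on the vectors of the
multiset `s`. -/
noncomputable def symDeriv (h : F → G) (x : F) (s : Multiset F) : G := dirDeriv h s.toList x

/-- The order chosen by `toList` is harmless by `dirDeriv_perm`. Comparing derivatives along
rearranged vectors becomes an identity of multisets. -/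
theorem iteratedFDeriv_eq_symDeriv {N n : ℕ} {h : F → G} {x : F} (hh : ContDiffAt ℝ N h x)
    (hn : n ≤ N) (v : Fin n → F) :
    iteratedFDeriv ℝ n h x v = symDeriv h x (∑ t, {v t}) := by
  obtain ⟨u, hu, hhu⟩ := hh.contDiffOn (m := N) le_rfl (by simp)
  obtain ⟨U, hUu, hU, hxU⟩ := mem_nhds_iff.1 hu
  rw [iteratedFDeriv_eq_dirDeriv hU (hhu.mono hUu) n hn v x hxU]
  refine dirDeriv_perm hU (hhu.mono hUu) ?_ (by simpa using hn) x hxU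
  rw [← Multiset.coe_eq_coe, Multiset.coe_toList, ← Fin.univ_val_map, Finset.sum]
  conv_lhs => rw [← Multiset.sum_map_singleton (Multiset.map v Finset.univ.val)]
  rw [Multiset.map_map]
  rfl

theorem derivProd_eq_symDeriv {N r : ℕ} {h : F → G} {x : F} (hh : ContDiffAt ℝ N h x)
    (v : Fin r → F) (c : Fin r → ℕ) (hc : ∑ j, c j ≤ N) :
    derivProd h x v c = symDeriv h x (∑ j, c j • {v j}) := by
  rw [derivProd, iteratedFDeriv_eq_symDeriv hh hc]
  congr 1
  rw [Equiv.sum_comp finSigmaFinEquiv.symm (fun p => ({v p.1} : Multiset F)), Fintype.sum_sigma]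
  simp

/-- The multinomial formula for the iterated derivative. -/
theorem iteratedFDeriv_sum_eq {N L r : ℕ} {h : F → G} {x : F} (hh : ContDiffAt ℝ N h x)
    (hL : L ≤ N) (w : Fin r → F) :
    iteratedFDeriv ℝ L h x (fun _ => ∑ j, w j) =
      ∑ c ∈ Finset.piAntidiag Finset.univ L,
        (Nat.multinomial Finset.univ c : ℝ) • derivProd h x w c := by
  -- A symmetric multilinear map factors through commutative polynomials, so the multinomial theorem
  -- for `(∑ X_j)^L` can be transported along `Φ`.
  let Φ : MvPolynomial (Fin r) ℝ →ₗ[ℝ] G := (MvPolynomial.basisMonomials (Fin r) ℝ).constr ℝ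
    fun c => symDeriv h x (∑ j, c j • {w j})
  have hΦ : ∀ c : Fin r → ℕ, Φ (∏ j, MvPolynomial.X j ^ c j) =
      symDeriv h x (∑ j, c j • {w j}) := by
    intro c
    have h1 : (∏ j, MvPolynomial.X j ^ c j : MvPolynomial (Fin r) ℝ) =
        MvPolynomial.basisMonomials (Fin r) ℝ (Finsupp.equivFunOnFinite.symm c) := by
      rw [MvPolynomial.coe_basisMonomials]
      simp [MvPolynomial.monomial_eq, Finsupp.prod_fintype]
    rw [h1, Module.Basis.constr_basis]
    simp
  have h1 : iteratedFDeriv ℝ L h x (fun _ => ∑ j, w j) =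
      Φ ((∑ j, MvPolynomial.X j) ^ L) := by
    rw [ContinuousMultilinearMap.map_sum, Finset.sum_pow', map_sum, Fintype.piFinset_univ]
    refine Finset.sum_congr rfl fun p _ => ?_
    rw [iteratedFDeriv_eq_symDeriv hh hL]
    rw [← Finset.sum_fiberwise' Finset.univ p fun j => ({w j} : Multiset F),
      ← Finset.prod_fiberwise' Finset.univ p fun j => (MvPolynomial.X j : MvPolynomial (Fin r) ℝ)]
    simp only [Finset.sum_const, Finset.prod_const]
    exact (hΦ _).symm
  rw [h1, Finset.sum_pow_eq_sum_piAntidiag, map_sum]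
  refine Finset.sum_congr rfl fun c hc => ?_
  rw [← nsmul_eq_mul, map_nsmul, hΦ, derivProd_eq_symDeriv hh, Nat.cast_smul_eq_nsmul]
  rw [Finset.mem_piAntidiag] at hc
  exact hc.1.trans_le hL

end Symmetry
-- Hadamard division by powers of the last variable.
section Division

universe w

/-- Differentiation under the integral, iterated. The induction replaces `G` by `H →L[ℝ] G`, so `G`
is quantified inside the statement and shares the universe of `H`. -/
theorem contDiff_parametric_integral {H : Type w} [NormedAddCommGroup H] [NormedSpace ℝ H]
    [FiniteDimensional ℝ H] (n : ℕ) :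
    ∀ {G : Type w} [NormedAddCommGroup G] [NormedSpace ℝ G] {f : H × ℝ → G},
      ContDiff ℝ n f → ContDiff ℝ n fun x => ∫ t in (0 : ℝ)..1, f (x, t) := by
  induction n with
  | zero =>
    intro G _ _ f hf
    have hf' : Continuous f := hf.continuous
    have h1 : Continuous fun x => ∫ t in (0 : ℝ)..1, f (x, t) :=
      intervalIntegral.continuous_parametric_intervalIntegral_of_continuous'
        (f := fun x t => f (x, t)) hf' 0 1
    exact_mod_cast contDiff_zero.2 h1
  | succ n ih =>
    intro G _ _ f hf
    have hf0 : Continuous f := hf.continuous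
    have hf1 : ContDiff ℝ n (fderiv ℝ f) := hf.fderiv_right (by simp)
    let f' : H × ℝ → H →L[ℝ] G := fun p => (fderiv ℝ f p).comp (ContinuousLinearMap.inl ℝ H ℝ)
    have hf' : ContDiff ℝ n f' := hf1.clm_comp contDiff_const
    have hd : ∀ x t, HasFDerivAt (fun y => f (y, t)) (f' (x, t)) x := by
      intro x t
      have h1 : HasFDerivAt f (fderiv ℝ f (x, t)) (x, t) :=
        (hf.differentiable (by simp) _).hasFDerivAt
      exact h1.comp x (hasFDerivAt_prodMk_left x t)
    refine contDiff_succ_iff_hasFDerivAt.2 ⟨fun x => ∫ t in (0 : ℝ)..1, f' (x, t), ih hf', ?_⟩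
    intro x
    obtain ⟨C, hC⟩ := (((isCompact_closedBall x 1).prod (isCompact_Icc (a := (0 : ℝ))
      (b := 1))).exists_bound_of_continuousOn hf'.continuous.continuousOn)
    refine intervalIntegral.hasFDerivAt_integral_of_dominated_of_fderiv_le
      (F := fun y t => f (y, t)) (F' := fun y t => f' (y, t)) (bound := fun _ => C)
      (Metric.closedBall_mem_nhds x one_pos) ?_ ?_ ?_ ?_ ?_ ?_
    · exact Eventually.of_forall fun y =>
        (by fun_prop : Continuous fun t => f (y, t)).aestronglyMeasurable
    · exact (by fun_prop : Continuous fun t => f (x, t)).intervalIntegrable _ _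
    · exact (hf'.continuous.comp (by fun_prop : Continuous fun t : ℝ => (x, t))).aestronglyMeasurable
    · refine Eventually.of_forall fun t ht y hy => hC (y, t) ⟨hy, ?_⟩
      rw [uIoc_of_le zero_le_one] at ht
      exact Ioc_subset_Icc_self ht
    · exact intervalIntegrable_const
    · exact Eventually.of_forall fun t _ y _ => hd y t

/-- A function of class `C^n` near a point agrees there with a globally `C^n` function. -/
theorem exists_contDiff_eventuallyEq {X G : Type*} [NormedAddCommGroup X] [NormedSpace ℝ X]
    [FiniteDimensional ℝ X] [NormedAddCommGroup G] [NormedSpace ℝ G] {n : ℕ} {f : X → G} {x : X}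
    (hf : ContDiffAt ℝ n f x) : ∃ F : X → G, ContDiff ℝ n F ∧ F =ᶠ[𝓝 x] f := by
  obtain ⟨u, hu, hfu⟩ := hf.contDiffOn (m := n) le_rfl (by simp)
  obtain ⟨r, hr, hru⟩ := Metric.mem_nhds_iff.1 hu
  -- The support radius `r / 2` is below `r`, so the product vanishes near every point outside the
  -- ball, where `f` is uncontrolled.
  let φ : ContDiffBump x := ⟨r / 4, r / 2, by positivity, by linarith⟩
  refine ⟨fun y => φ y • f y, contDiff_iff_contDiffAt.2 fun y => ?_, ?_⟩
  · by_cases hy : y ∈ Metric.ball x r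
    · exact φ.contDiff.contDiffAt.smul ((hfu.mono hru).contDiffAt (Metric.isOpen_ball.mem_nhds hy))
    · have h1 : ∀ᶠ z in 𝓝 y, (r / 2) < dist z x := by
        have h2 : r / 2 < dist y x := by
          rw [Metric.mem_ball, not_lt] at hy
          linarith
        exact (continuous_id.dist continuous_const).continuousAt.eventually_const_lt h2
      have h3 : (fun z => φ z • f z) =ᶠ[𝓝 y] fun _ => 0 := by
        filter_upwards [h1] with z hz
        rw [φ.zero_of_le_dist hz.le, zero_smul]
      exact contDiffAt_const.congr_of_eventuallyEq h3
  · filter_upwards [φ.eventuallyEq_one] with y hy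
    simp [hy]

/-- Hadamard's lemma in the last variable. -/
theorem exists_eq_add_smul {X G : Type w} [NormedAddCommGroup X] [NormedSpace ℝ X]
    [FiniteDimensional ℝ X] [NormedAddCommGroup G] [NormedSpace ℝ G] [CompleteSpace G]
    {n : ℕ} {u : X × ℝ → G} {x : X}
    (hu : ContDiffAt ℝ (n + 1 : ℕ) u (x, 0)) :
    ∃ v : X × ℝ → G, ContDiffAt ℝ n v (x, 0) ∧
      ∀ᶠ p in 𝓝 (x, (0 : ℝ)), u p = u (p.1, 0) + p.2 • v p := by
  obtain ⟨U, hU, hUu⟩ := exists_contDiff_eventuallyEq hu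
  -- The quotient is `∫₀¹ ∂_ε U(y, tε) dt`, which costs one derivative.
  have hf : ContDiff ℝ n fun q : (X × ℝ) × ℝ => fderiv ℝ U (q.1.1, q.2 * q.1.2) (0, 1) := by
    have h1 : ContDiff ℝ n (fderiv ℝ U) := hU.fderiv_right (by simp)
    exact (h1.comp (by fun_prop)).clm_apply contDiff_const
  refine ⟨_, (contDiff_parametric_integral n hf).contDiffAt, ?_⟩
  have h0 : Tendsto (fun p : X × ℝ => (p.1, (0 : ℝ))) (𝓝 (x, 0)) (𝓝 (x, 0)) :=
    (by fun_prop : Continuous fun p : X × ℝ => (p.1, (0 : ℝ))).tendsto' _ _ rfl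
  filter_upwards [hUu, h0.eventually hUu] with p hp hp0
  rw [← hp, ← hp0]
  have hd : ∀ t ∈ uIcc (0 : ℝ) 1, HasDerivAt (fun t : ℝ => U (p.1, t * p.2))
      (p.2 • fderiv ℝ U (p.1, t * p.2) (0, 1)) t := by
    intro t _
    have h1 : HasDerivAt (fun t : ℝ => (p.1, t * p.2)) ((0 : X), p.2) t := by
      simpa using (hasDerivAt_const t p.1).prodMk ((hasDerivAt_id t).mul_const p.2)
    have h2 := ((hU.differentiable (by simp) (p.1, t * p.2)).hasFDerivAt).comp_hasDerivAt t h1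
    rw [← map_smul]
    simpa [Function.comp_def] using h2
  have hc : Continuous fun t : ℝ => fderiv ℝ U (p.1, t * p.2) (0, 1) :=
    hf.continuous.comp (by fun_prop : Continuous fun t : ℝ => (p, t))
  have h3 := intervalIntegral.integral_eq_sub_of_hasDerivAt hd
    ((hc.const_smul p.2).intervalIntegrable _ _)
  rw [intervalIntegral.integral_smul] at h3
  rw [h3]
  simp

/-- Each division costs one derivative. Unlike a bare `O`-remainder, the quotient `v` stays
differentiable, so an implicit function theorem can be applied to it. -/
theorem exists_expansion {X G : Type w} [NormedAddCommGroup X] [NormedSpace ℝ X]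
    [FiniteDimensional ℝ X] [NormedAddCommGroup G] [NormedSpace ℝ G] [CompleteSpace G]
    {u : X × ℝ → G} {x : X} (j n : ℕ) (hu : ContDiffAt ℝ (n + j : ℕ) u (x, 0)) :
    ∃ (a : ℕ → X → G) (v : X × ℝ → G), ContDiffAt ℝ n v (x, 0) ∧
      ∀ᶠ p in 𝓝 (x, (0 : ℝ)),
        u p = ∑ i ∈ Finset.range j, p.2 ^ i • a i p.1 + p.2 ^ j • v p := by
  induction j generalizing n with
  | zero => exact ⟨fun _ _ => 0, u, hu, by simp⟩
  | succ j ih =>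
    obtain ⟨a, v, hv, h⟩ := ih (n + 1) (by convert hu using 2; ring)
    obtain ⟨w, hw, h'⟩ := exists_eq_add_smul hv
    refine ⟨fun i y => if i = j then v (y, 0) else a i y, w, hw, ?_⟩
    filter_upwards [h, h'] with p hp hp'
    rw [hp, hp', Finset.sum_range_succ, smul_add, smul_smul, ← pow_succ, add_assoc]
    simp only [if_true]
    congr 1
    exact Finset.sum_congr rfl fun i hi => by rw [if_neg (Finset.mem_range.1 hi).ne]

end Division
-- Asymptotic expansions in powers of `ε`, and Taylor's formula.
section Expansion

variable {F G : Type*} [NormedAddCommGroup F] [NormedSpace ℝ F]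
  [NormedAddCommGroup G] [NormedSpace ℝ G]

theorem isBigO_pow_smul {d n : ℕ} (hd : d ≤ n) (a : G) :
    (fun ε : ℝ => ε ^ n • a) =O[𝓝 0] fun ε : ℝ => ε ^ d := by
  have h1 : (fun ε : ℝ => ε ^ n) =O[𝓝 0] fun ε : ℝ => ε ^ d := by
    obtain ⟨e, rfl⟩ := Nat.exists_eq_add_of_le hd
    have h2 : (fun ε : ℝ => ε ^ e) =O[𝓝 0] fun _ => (1 : ℝ) :=
      ((continuous_pow e).tendsto (0 : ℝ)).isBigO_one ℝ
    simpa [pow_add] using (isBigO_refl (fun ε : ℝ => ε ^ d) (𝓝 0)).mul h2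
  simpa using h1.smul (isBigO_const_const a (one_ne_zero (α := ℝ)) (𝓝 (0 : ℝ)))

/-- Truncation of a finite sum of monomials. -/
theorem isBigO_sum_sub_sum_fiber {ι : Type*} (S : Finset ι) (w : ι → ℕ) (A : ι → G) (d : ℕ) :
    (fun ε : ℝ => ∑ x ∈ S, ε ^ w x • A x -
      ∑ s ∈ Finset.range d, ε ^ s • ∑ x ∈ S with w x = s, A x)
      =O[𝓝 0] fun ε : ℝ => ε ^ d := by
  have h1 : ∀ ε : ℝ, ∑ x ∈ S, ε ^ w x • A x -
      ∑ s ∈ Finset.range d, ε ^ s • ∑ x ∈ S with w x = s, A x =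
      ∑ x ∈ S with ¬ w x < d, ε ^ w x • A x := by
    intro ε
    rw [← Finset.sum_filter_add_sum_filter_not S (fun x => w x < d), sub_eq_iff_eq_add, add_comm]
    congr 1
    rw [← Finset.sum_fiberwise_of_maps_to (t := Finset.range d) (g := w) (by simp)]
    refine Finset.sum_congr rfl fun s hs => ?_
    rw [Finset.mem_range] at hs
    rw [Finset.smul_sum, Finset.filter_filter]
    refine Finset.sum_congr ?_ ?_
    · ext x
      simp only [Finset.mem_filter]
      grind
    · intro x hx
      rw [(Finset.mem_filter.1 hx).2]
  simp only [h1]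
  exact IsBigO.fun_sum fun x hx =>
    isBigO_pow_smul (n := w x) (by simpa using (Finset.mem_filter.1 hx).2) (A x)

/-- Letting `ε → 0` kills `a 0`; dividing by `ε`, which is why the neighbourhood is punctured,
lowers `d`. -/
theorem eq_zero_of_sum_pow_smul_isBigO (d : ℕ) : ∀ (a : ℕ → G),
    (fun ε : ℝ => ∑ i ∈ Finset.range d, ε ^ i • a i) =O[𝓝[≠] 0] (fun ε : ℝ => ε ^ d) →
    ∀ i < d, a i = 0 := by
  induction d with
  | zero => intro a _ i hi; omega
  | succ d ih =>
    intro a ha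
    have h0 : a 0 = 0 := by
      have h1 : Tendsto (fun ε : ℝ => ∑ i ∈ Finset.range (d + 1), ε ^ i • a i) (𝓝[≠] 0)
          (𝓝 (a 0)) := by
        have h2 : Continuous fun ε : ℝ => ∑ i ∈ Finset.range (d + 1), ε ^ i • a i := by fun_prop
        refine (h2.tendsto' 0 (a 0) ?_).mono_left nhdsWithin_le_nhds
        simp [Finset.sum_range_succ']
      have h3 : Tendsto (fun ε : ℝ => ε ^ (d + 1)) (𝓝[≠] 0) (𝓝 0) :=
        ((continuous_pow (d + 1)).tendsto' 0 0 (by simp)).mono_left nhdsWithin_le_nhds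
      exact tendsto_nhds_unique h1 (ha.trans_tendsto h3)
    have h1 : (fun ε : ℝ => ∑ i ∈ Finset.range d, ε ^ i • a (i + 1)) =O[𝓝[≠] 0]
        (fun ε : ℝ => ε ^ d) := by
      have h2 := (isBigO_refl (fun ε : ℝ => ε⁻¹) (𝓝[≠] 0)).smul ha
      refine h2.congr' ?_ ?_
      · filter_upwards [self_mem_nhdsWithin] with ε hε
        have hε : ε ≠ 0 := hε
        rw [Finset.sum_range_succ', h0, smul_zero, add_zero, Finset.smul_sum]
        refine Finset.sum_congr rfl fun i _ => ?_
        rw [smul_smul, pow_succ']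
        field_simp
      · filter_upwards [self_mem_nhdsWithin] with ε hε
        have hε : ε ≠ 0 := hε
        rw [smul_eq_mul, pow_succ']
        field_simp
    intro i hi
    cases i with
    | zero => exact h0
    | succ i => exact ih _ h1 i (by omega)

/-- The coefficients of an asymptotic expansion in powers of `ε` are unique. -/
theorem expansion_unique {d : ℕ} {u : ℝ → G} {a b : ℕ → G}
    (ha : (fun ε : ℝ => u ε - ∑ i ∈ Finset.range d, ε ^ i • a i) =O[𝓝[≠] 0] fun ε : ℝ => ε ^ d)
    (hb : (fun ε : ℝ => u ε - ∑ i ∈ Finset.range d, ε ^ i • b i) =O[𝓝[≠] 0] fun ε : ℝ => ε ^ d) :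
    ∀ i < d, a i = b i := by
  intro i hi
  refine sub_eq_zero.1 (eq_zero_of_sum_pow_smul_isBigO d (fun i => a i - b i) ?_ i hi)
  refine (hb.sub ha).congr_left fun ε => ?_
  simp only [smul_sub, Finset.sum_sub_distrib]
  abel

/-- The integral remainder is bounded because the derivative of order `k + 1` is continuous at `x`,
hence bounded by `C` nearby. -/
theorem taylor_isBigO [CompleteSpace G] {h : F → G} {x : F} {k : ℕ}
    (hh : ContDiffAt ℝ (k + 1 : ℕ) h x) :
    (fun y => h (x + y) - ∑ L ∈ Finset.range (k + 1),
      (L.factorial : ℝ)⁻¹ • iteratedFDeriv ℝ L h x (fun _ => y)) =O[𝓝 0]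
      fun y => ‖y‖ ^ (k + 1) := by
  obtain ⟨u, hu, hhu⟩ := hh.contDiffOn (m := (k + 1 : ℕ)) le_rfl (by simp)
  have hc : ContinuousAt (fun y => ‖iteratedFDeriv ℝ (k + 1) h y‖) x :=
    ((hh.iteratedFDeriv_right (i := k + 1) (m := 0) (by simp)).continuousAt).norm
  set C := ‖iteratedFDeriv ℝ (k + 1) h x‖ + 1 with hC
  have hev : ∀ᶠ y in 𝓝 x, y ∈ interior u ∧ ‖iteratedFDeriv ℝ (k + 1) h y‖ ≤ C :=
    Filter.Eventually.and (interior_mem_nhds.2 hu) ((hc.eventually_lt_const (by linarith)).mono fun _ h => h.le)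
  obtain ⟨r, hr, hrs⟩ := Metric.eventually_nhds_iff_ball.1 hev
  refine IsBigO.of_bound ((k.factorial : ℝ)⁻¹ * C) ?_
  filter_upwards [Metric.ball_mem_nhds (0 : F) hr] with y hy
  rw [mem_ball_zero_iff] at hy
  have hseg : ∀ t ∈ Icc (0 : ℝ) 1, x + t • y ∈ Metric.ball x r := by
    intro t ht
    rw [mem_ball_iff_norm, add_sub_cancel_left, norm_smul, Real.norm_of_nonneg ht.1]
    exact (mul_le_of_le_one_left (norm_nonneg _) ht.2).trans_lt hy
  have h1 := map_add_eq_sum_add_integral_iteratedFDeriv (f := h) (x := x) (y := y) (n := k)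
    fun t ht => by
      have := mem_interior_iff_mem_nhds.1 (hrs _ (hseg t ht)).1
      exact_mod_cast hhu.contDiffAt this
  rw [h1, add_sub_cancel_left, norm_smul, norm_inv, RCLike.norm_natCast, mul_assoc]
  gcongr
  have h2 : ∀ t ∈ uIoc (0 : ℝ) 1,
      ‖(1 - t) ^ k • iteratedFDeriv ℝ (k + 1) h (x + t • y) (fun _ => y)‖
        ≤ C * ‖y‖ ^ (k + 1) := by
    intro t ht
    rw [uIoc_of_le zero_le_one] at ht
    rw [norm_smul]
    have h3 : ‖(1 - t) ^ k‖ ≤ 1 := by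
      rw [norm_pow, Real.norm_of_nonneg (by linarith [ht.2])]
      exact pow_le_one₀ (by linarith [ht.2]) (by linarith [ht.1])
    refine (mul_le_of_le_one_left (norm_nonneg _) h3).trans ?_
    refine (ContinuousMultilinearMap.le_opNorm _ _).trans ?_
    simp only [Finset.prod_const, Finset.card_univ, Fintype.card_fin]
    gcongr
    exact (hrs _ (hseg t (Ioc_subset_Icc_self ht))).2
  simpa using intervalIntegral.norm_integral_le_of_norm_le_const h2

/-! ### The sums over tuples -/

theorem derivProd_congr_zero {N r : ℕ} {h : F → G} {x : F} (hh : ContDiffAt ℝ N h x)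
    (v : Fin (r + 1) → F) (c : Fin r → ℕ) (hc : ∑ j, c j ≤ N) :
    derivProd h x v (Fin.snoc c 0 : Fin (r + 1) → ℕ) = derivProd h x (fun j => v j.castSucc) c := by
  rw [derivProd_eq_symDeriv hh _ _ hc, derivProd_eq_symDeriv hh _ _ (by
    simpa [Fin.sum_univ_castSucc] using hc)]
  simp [Fin.sum_univ_castSucc]

theorem sum_le_of_mem_tuples {r s : ℕ} {c : Fin r → ℕ} (hc : c ∈ tuples r s) :
    ∑ j, c j ≤ s := by
  rw [← mem_tuples.1 hc]
  exact Finset.sum_le_sum fun j _ => Nat.le_mul_of_pos_left _ (Nat.succ_pos _)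

theorem snoc_zero_mem_tuples {r s : ℕ} {c : Fin r → ℕ} :
    (Fin.snoc c 0 : Fin (r + 1) → ℕ) ∈ tuples (r + 1) s ↔ c ∈ tuples r s := by
  simp [mem_tuples, Fin.sum_univ_castSucc]

theorem coeff_snoc_zero {r : ℕ} (c : Fin r → ℕ) :
    coeff (Fin.snoc c 0 : Fin (r + 1) → ℕ) = coeff c := by
  simp [coeff, Fin.prod_univ_castSucc]

theorem sum_filter_last_eq_zero {N r s : ℕ} {h : F → G} {x : F} (hh : ContDiffAt ℝ N h x)
    (hs : s ≤ N) (v : Fin (r + 1) → F) :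
    ∑ c ∈ tuples (r + 1) s with c (Fin.last r) = 0, coeff c • derivProd h x v c =
      bellSum h x r s fun j => v j.castSucc := by
  symm
  refine Finset.sum_bij (fun c _ => (Fin.snoc c 0 : Fin (r + 1) → ℕ)) ?_ ?_ ?_ ?_
  · intro c hc
    simp [snoc_zero_mem_tuples, hc]
  · intro c _ c' _ hcc
    exact (Fin.snoc_inj.1 hcc).1
  · intro c hc
    rw [Finset.mem_filter] at hc
    have h1 : (Fin.snoc (fun j => c j.castSucc) 0 : Fin (r + 1) → ℕ) = c := by
      rw [← hc.2]
      exact Fin.snoc_init_self c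
    exact ⟨fun j => c j.castSucc, snoc_zero_mem_tuples.1 (h1.symm ▸ hc.1 :), h1⟩
  · intro c hc
    rw [coeff_snoc_zero, derivProd_congr_zero hh _ _ ((sum_le_of_mem_tuples hc).trans hs)]

/-- The last entry has weight `r + 1 > s`, so it must be zero. -/
theorem bellSum_succ_of_le {N r s : ℕ} {h : F → G} {x : F} (hh : ContDiffAt ℝ N h x)
    (hs : s ≤ N) (hr : s ≤ r) (v : Fin (r + 1) → F) :
    bellSum h x (r + 1) s v = bellSum h x r s fun j => v j.castSucc := by
  rw [← sum_filter_last_eq_zero hh hs, bellSum, Finset.filter_true_of_mem]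
  intro c hc
  have h1 := mem_tuples.1 hc
  rw [Fin.sum_univ_castSucc, Fin.val_last] at h1
  by_contra h2
  have : (r + 1) * 1 ≤ (r + 1) * c (Fin.last r) := Nat.mul_le_mul_left _ (by omega)
  omega

theorem bellSum_of_le {N s : ℕ} {h : F → G} {x : F} (hh : ContDiffAt ℝ N h x)
    (hs : s ≤ N) (w : ℕ → F) {r : ℕ} (hr : s ≤ r) :
    bellSum h x r s (fun j => w j) = bellSum h x s s fun j => w j := by
  induction r, hr using Nat.le_induction with
  | base => rfl
  | succ r hr ih => rw [bellSum_succ_of_le hh hs hr, ← ih]; rfl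

/-- Only one tuple has a nonzero last entry: a single `1` there exhausts the weight `r + 1`. This
isolates the linear term in the newest vector, which makes the recursion for `γ` solvable. -/
theorem bellSum_succ_self {N r : ℕ} {h : F → G} {x : F} (hh : ContDiffAt ℝ N h x)
    (hr : r + 1 ≤ N) (v : Fin (r + 1) → F) :
    bellSum h x (r + 1) (r + 1) v = (bellSum h x r (r + 1) fun j => v j.castSucc) +
      ((r + 1).factorial : ℝ)⁻¹ • fderiv ℝ h x (v (Fin.last r)) := by
  rw [← sum_filter_last_eq_zero hh hr, bellSum,
    ← Finset.sum_filter_add_sum_filter_not _ fun c => c (Fin.last r) = 0]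
  congr 1
  have h1 : (tuples (r + 1) (r + 1)).filter (fun c => ¬ c (Fin.last r) = 0) =
      {Pi.single (Fin.last r) 1} := by
    ext c
    rw [Finset.mem_filter, Finset.mem_singleton, mem_tuples]
    constructor
    · rintro ⟨h1, h2⟩
      rw [Fin.sum_univ_castSucc, Fin.val_last] at h1
      have h3 : c (Fin.last r) = 1 := by
        by_contra h4
        have : (r + 1) * 2 ≤ (r + 1) * c (Fin.last r) := Nat.mul_le_mul_left _ (by omega)
        omega
      rw [h3, mul_one, Nat.add_eq_right, Finset.sum_eq_zero_iff] at h1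
      ext j
      refine Fin.lastCases ?_ (fun i => ?_) j
      · simp [h3]
      · have := h1 i (Finset.mem_univ i)
        simpa [Pi.single_apply, (Fin.castSucc_lt_last i).ne] using this
    · rintro rfl
      simp [Pi.single_apply]
  rw [h1, Finset.sum_singleton, derivProd_eq_symDeriv hh _ _ (by simp; omega)]
  congr 1
  · rw [coeff, Fin.prod_univ_castSucc]
    simp [(Fin.castSucc_lt_last _).ne]
  · have h2 := iteratedFDeriv_eq_symDeriv hh (n := 1) (by omega) fun _ => v (Fin.last r)
    rw [iteratedFDeriv_one_apply] at h2
    rw [h2, Fin.sum_univ_castSucc]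
    simp [(Fin.castSucc_lt_last _).ne]

end Expansion
-- Expansion of a composition by powers of `ε`.
section Composition

variable {F G : Type*} [NormedAddCommGroup F] [NormedSpace ℝ F]
  [NormedAddCommGroup G] [NormedSpace ℝ G]

theorem derivProd_smul {r : ℕ} (h : F → G) (x : F) (a : Fin r → ℝ) (v : Fin r → F)
    (c : Fin r → ℕ) :
    derivProd h x (fun j => a j • v j) c = (∏ j, a j ^ c j) • derivProd h x v c := by
  rw [derivProd, ContinuousMultilinearMap.map_smul_univ, derivProd]
  congr 1
  rw [Equiv.prod_comp finSigmaFinEquiv.symm (fun p => a p.1), Fintype.prod_sigma]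
  simp

/-- One term of the expansion of `h (x + ∑ ε ^ j • v_j)`. -/
theorem multinomial_smul_derivProd {r : ℕ} (h : F → G) (x : F) (v : ℕ → F) (c : Fin r → ℕ)
    (ε : ℝ) :
    (((∑ j, c j).factorial : ℝ)⁻¹ * (Nat.multinomial Finset.univ c : ℝ)) •
      derivProd h x (fun j : Fin r => ε ^ ((j : ℕ) + 1) • v (j + 1)) c =
    ε ^ (∑ j : Fin r, ((j : ℕ) + 1) * c j) • coeff c •
      derivProd h x (fun j : Fin r => (((j : ℕ) + 1).factorial : ℝ) • v (j + 1)) c := by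
  rw [derivProd_smul, derivProd_smul, smul_smul, smul_smul, smul_smul]
  congr 1
  have h1 := Nat.multinomial_spec Finset.univ c
  have h2 : ((∏ j, (c j).factorial : ℕ) : ℝ) * (Nat.multinomial Finset.univ c : ℝ) =
      ((∑ j, c j).factorial : ℝ) := by exact_mod_cast h1
  have h3 : ((∑ j, c j).factorial : ℝ) ≠ 0 := by positivity
  have h4 : (∏ j : Fin r, (((j : ℕ) + 1).factorial : ℝ) ^ c j) ≠ 0 :=
    Finset.prod_ne_zero_iff.2 fun j _ => by positivity
  have h5 : (∏ j, ((c j).factorial : ℝ)) ≠ 0 :=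
    Finset.prod_ne_zero_iff.2 fun j _ => by positivity
  rw [coeff, Finset.prod_mul_distrib, ← Finset.prod_pow_eq_pow_sum]
  simp only [pow_mul]
  push_cast at h2
  field_simp
  rw [← h2]
  ring

/-- Faà di Bruno's formula in asymptotic form. The `v j` are Taylor coefficients, so `j! v_j` plays
the role of the `j`-th derivative. -/
theorem comp_expansion [CompleteSpace G] {k : ℕ} {h : F → G} {b : ℝ → F} {v : ℕ → F}
    (hh : ContDiffAt ℝ (k + 1 : ℕ) h (v 0))
    (hb : (fun ε : ℝ => b ε - ∑ i ∈ Finset.range (k + 1), ε ^ i • v i)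
      =O[𝓝 0] fun ε : ℝ => ε ^ (k + 1)) :
    (fun ε : ℝ => h (b ε) - ∑ l ∈ Finset.range (k + 1), ε ^ l •
      bellSum h (v 0) l l fun j : Fin l => (((j : ℕ) + 1).factorial : ℝ) • v (j + 1))
      =O[𝓝 0] fun ε : ℝ => ε ^ (k + 1) := by
  set p : ℝ → F := fun ε => ∑ j : Fin k, ε ^ ((j : ℕ) + 1) • v (j + 1) with hp
  have hpv : ∀ ε : ℝ, ∑ i ∈ Finset.range (k + 1), ε ^ i • v i = v 0 + p ε := by
    intro ε
    rw [Finset.sum_range_succ', hp, Finset.sum_range, add_comm]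
    simp
  simp only [hpv] at hb
  have hpc : Continuous p := by fun_prop
  have hp0 : Tendsto p (𝓝 0) (𝓝 0) := hpc.tendsto' 0 0 (by simp [hp])
  have hpO : (fun ε => ‖p ε‖ ^ (k + 1)) =O[𝓝 0] fun ε : ℝ => ε ^ (k + 1) := by
    refine IsBigO.pow (IsBigO.norm_left ?_) _
    refine IsBigO.fun_sum fun j _ => ?_
    simpa using isBigO_pow_smul (d := 1) (n := (j : ℕ) + 1) (by omega) (v (j + 1))
  have hpow : Tendsto (fun ε : ℝ => ε ^ (k + 1)) (𝓝 0) (𝓝 0) :=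
    (continuous_pow (k + 1)).tendsto' 0 0 (by simp)
  have hvp : Tendsto (fun ε => v 0 + p ε) (𝓝 0) (𝓝 (v 0)) := by
    simpa using hp0.const_add (v 0)
  have hbt : Tendsto b (𝓝 0) (𝓝 (v 0)) := by
    simpa using (hb.trans_tendsto hpow).add hvp
  -- Strict differentiability makes `h` Lipschitz near `v 0`, so `b` may be replaced by its
  -- polynomial part.
  have h1 : (fun ε => h (b ε) - h (v 0 + p ε)) =O[𝓝 0] fun ε : ℝ => ε ^ (k + 1) := by
    have h2 := (hh.hasStrictFDerivAt (by simp)).isBigO_sub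
    exact (h2.comp_tendsto (hbt.prodMk_nhds hvp)).trans hb
  have h2 := ((taylor_isBigO hh).comp_tendsto hp0).trans hpO
  let S : Finset (Σ _ : ℕ, Fin k → ℕ) :=
    (Finset.range (k + 1)).sigma fun L => Finset.piAntidiag Finset.univ L
  let w : (Σ _ : ℕ, Fin k → ℕ) → ℕ := fun x => ∑ j : Fin k, ((j : ℕ) + 1) * x.2 j
  let A : (Σ _ : ℕ, Fin k → ℕ) → G := fun x => coeff x.2 •
    derivProd h (v 0) (fun j : Fin k => (((j : ℕ) + 1).factorial : ℝ) • v (j + 1)) x.2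
  have h3 : ∀ ε : ℝ, ∑ L ∈ Finset.range (k + 1),
      (L.factorial : ℝ)⁻¹ • iteratedFDeriv ℝ L h (v 0) (fun _ => p ε) =
      ∑ x ∈ S, ε ^ w x • A x := by
    intro ε
    rw [Finset.sum_sigma]
    refine Finset.sum_congr rfl fun L hL => ?_
    rw [iteratedFDeriv_sum_eq hh (Finset.mem_range.1 hL).le, Finset.smul_sum]
    refine Finset.sum_congr rfl fun c hc => ?_
    obtain rfl : ∑ j, c j = L := (Finset.mem_piAntidiag.1 hc).1
    rw [smul_smul]
    exact multinomial_smul_derivProd h (v 0) v c ε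
  have h4 := isBigO_sum_sub_sum_fiber S w A (k + 1)
  -- Weight `s ≤ k` forces `|c| ≤ s`, so truncating at `L ≤ k` loses nothing; entries beyond
  -- position `s` vanish.
  have h5 : ∀ s ∈ Finset.range (k + 1), ∑ x ∈ S with w x = s, A x = bellSum h (v 0) s s
      fun j : Fin s => (((j : ℕ) + 1).factorial : ℝ) • v (j + 1) := by
    intro s hs
    rw [Finset.mem_range] at hs
    rw [← bellSum_of_le hh hs.le (fun j => ((j + 1).factorial : ℝ) • v (j + 1))
      (Nat.lt_succ_iff.1 hs), bellSum]
    refine Finset.sum_bij' (fun x _ => x.2) (fun c _ => ⟨∑ j, c j, c⟩) ?_ ?_ ?_ ?_ ?_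
    · intro x hx
      exact mem_tuples.2 (Finset.mem_filter.1 hx).2
    · intro c hc
      have := sum_le_of_mem_tuples hc
      simp only [S, w, Finset.mem_filter, Finset.mem_sigma, Finset.mem_range,
        Finset.mem_piAntidiag]
      exact ⟨⟨by omega, trivial, by simp⟩, mem_tuples.1 hc⟩
    · rintro ⟨L, c⟩ hx
      simp only [S, Finset.mem_filter, Finset.mem_sigma, Finset.mem_piAntidiag] at hx
      obtain rfl : ∑ j, c j = L := hx.1.2.1
      rfl
    · exact fun _ _ => rfl
    · exact fun _ _ => rfl
  refine ((h1.add h2).add h4).congr_left fun ε => ?_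
  rw [Finset.sum_congr (s₁ := Finset.range (k + 1)) (s₂ := Finset.range (k + 1)) rfl
    fun s hs => congrArg (fun y => ε ^ s • y) (h5 s hs).symm]
  simp only [Function.comp_apply, h3]
  abel

/-- The expansion of `∑ ε ^ i • h_i (b(ε))`. -/
theorem sum_comp_expansion [CompleteSpace G] {k : ℕ} {h : ℕ → F → G} {b : ℝ → F} {v : ℕ → F}
    (hh : ∀ i ≤ k, ContDiffAt ℝ (k + 1 : ℕ) (h i) (v 0))
    (hb : (fun ε : ℝ => b ε - ∑ i ∈ Finset.range (k + 1), ε ^ i • v i)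
      =O[𝓝 0] fun ε : ℝ => ε ^ (k + 1)) :
    (fun ε : ℝ => ∑ i ∈ Finset.range (k + 1), ε ^ i • h i (b ε) -
      ∑ s ∈ Finset.range (k + 1), ε ^ s • ∑ l ∈ Finset.range (s + 1),
        bellSum (h (s - l)) (v 0) l l fun j : Fin l => (((j : ℕ) + 1).factorial : ℝ) • v (j + 1))
      =O[𝓝 0] fun ε : ℝ => ε ^ (k + 1) := by
  let A : ℕ × ℕ → G := fun x => bellSum (h x.1) (v 0) x.2 x.2
    fun j : Fin x.2 => (((j : ℕ) + 1).factorial : ℝ) • v (j + 1)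
  let S := Finset.range (k + 1) ×ˢ Finset.range (k + 1)
  have h1 : (fun ε : ℝ => ∑ i ∈ Finset.range (k + 1), ε ^ i •
      (h i (b ε) - ∑ l ∈ Finset.range (k + 1), ε ^ l • A (i, l)))
      =O[𝓝 0] fun ε : ℝ => ε ^ (k + 1) := by
    refine IsBigO.fun_sum fun i hi => ?_
    have h2 := comp_expansion (hh i (Nat.lt_succ_iff.1 (Finset.mem_range.1 hi))) hb
    have h3 : (fun ε : ℝ => ε ^ i) =O[𝓝 0] fun _ => (1 : ℝ) :=
      ((continuous_pow i).tendsto (0 : ℝ)).isBigO_one ℝ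
    simpa using h3.smul h2
  have h4 := isBigO_sum_sub_sum_fiber S (fun x => x.1 + x.2) A (k + 1)
  have h5 : ∀ s ∈ Finset.range (k + 1), ∑ x ∈ S with x.1 + x.2 = s, A x =
      ∑ l ∈ Finset.range (s + 1), A (s - l, l) := by
    intro s hs
    rw [Finset.mem_range] at hs
    refine Finset.sum_bij' (fun x _ => x.2) (fun l _ => (s - l, l)) ?_ ?_ ?_ ?_ ?_ <;>
      simp only [S, Finset.mem_filter, Finset.mem_product, Finset.mem_range]
    · omega
    · omega
    · rintro ⟨i, l⟩ hx
      have : s - l = i := by omega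
      simp [this]
    · simp
    · rintro ⟨i, l⟩ hx
      have : s - l = i := by omega
      simp [this]
  refine (h1.add h4).congr_left fun ε => ?_
  have h7 := Finset.sum_congr rfl fun s hs => congrArg (fun y => ε ^ s • y) (h5 s hs)
  have h6 : ∑ x ∈ S, ε ^ (x.1 + x.2) • A x =
      ∑ i ∈ Finset.range (k + 1), ε ^ i • ∑ l ∈ Finset.range (k + 1), ε ^ l • A (i, l) := by
    rw [Finset.sum_product]
    refine Finset.sum_congr rfl fun i _ => ?_
    rw [Finset.smul_sum]
    exact Finset.sum_congr rfl fun l _ => by rw [smul_smul, pow_add]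
  rw [h7, h6]
  simp only [smul_sub, Finset.sum_sub_distrib]
  abel

end Composition
-- Identification of the coefficients with `γ_i` and `f_i` at a fixed parameter.
section FixedParameter

variable {E F : Type*} [NormedAddCommGroup F] [NormedSpace ℝ F]

/-- The coefficient of order `i + 1` is `Δ v_{i+1}` plus terms in earlier `v_j`, known by strong
induction. Inverting `Δ` reproduces the definition of `gam`. -/
theorem gam_eq_of_sum_bellSum_eq_zero {k : ℕ} {g : ℕ → E × F → E × F} {β : E → F} {α : E}
    (hg : ContDiffAt ℝ (k + 1 : ℕ) (fun b => (g 0 (α, b)).2) (β α))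
    (hΔ : (Delta (g 0) β α).IsInvertible) {v : ℕ → F}
    (hz : ∀ s ≤ k, ∑ l ∈ Finset.range (s + 1), bellSum (fun b => (g (s - l) (α, b)).2) (β α) l l
      (fun j : Fin l => (((j : ℕ) + 1).factorial : ℝ) • v (j + 1)) = 0) :
    ∀ i < k, gam g β (i + 1) α = ((i + 1).factorial : ℝ) • v (i + 1) := by
  intro i
  induction i using Nat.strong_induction_on with
  | _ i ih =>
    intro hi
    have hfac : ((i + 1).factorial : ℝ) ≠ 0 := by positivity
    have hgam : ∀ l ≤ i, (fun j : Fin l => gam g β ((j : ℕ) + 1) α) =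
        fun j : Fin l => (((j : ℕ) + 1).factorial : ℝ) • v (j + 1) := fun l hl =>
      funext fun j => ih j (j.2.trans_le hl) (by omega)
    have h1 := hz (i + 1) hi
    rw [Finset.sum_range_succ, Nat.sub_self, bellSum_succ_self hg (by omega)] at h1
    have h2 : ∑ l : Fin (i + 1), bellSum (fun b => (g (i + 1 - l) (α, b)).2) (β α) l l
        (fun j : Fin (l : ℕ) => gam g β ((j : ℕ) + 1) α) =
        ∑ l ∈ Finset.range (i + 1), bellSum (fun b => (g (i + 1 - l) (α, b)).2) (β α) l l
          (fun j : Fin l => (((j : ℕ) + 1).factorial : ℝ) • v (j + 1)) := by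
      rw [Finset.sum_range]
      exact Finset.sum_congr rfl fun l _ => by rw [hgam l (by omega)]
    rw [gam, h2, hgam i le_rfl]
    simp only [Fin.val_castSucc, Fin.val_last, map_smul, smul_smul, inv_mul_cancel₀ hfac,
      one_smul] at h1
    rw [← add_assoc, add_comm (Finset.sum _ _)] at h1
    rw [eq_neg_of_add_eq_zero_left h1, map_neg, smul_neg, neg_neg]
    congr 1
    obtain ⟨e, he⟩ := hΔ
    change (Delta (g 0) β α).inverse (Delta (g 0) β α (v (i + 1))) = v (i + 1)
    rw [← he, ContinuousLinearMap.inverse_equiv]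
    exact e.symm_apply_apply _

theorem bellSum_zero_zero {G : Type*} [NormedAddCommGroup G] [NormedSpace ℝ G] (h : F → G) (x : F)
    (v : Fin 0 → F) : bellSum h x 0 0 v = h x := by
  have h1 : tuples 0 0 = {Fin.elim0} := by
    ext c
    simp [mem_tuples, Subsingleton.elim c Fin.elim0]
  rw [bellSum, h1, Finset.sum_singleton]
  have h2 : derivProd h x v Fin.elim0 = h x := iteratedFDeriv_zero_apply _
  simp [coeff, h2]

variable [NormedAddCommGroup E] [NormedSpace ℝ E]

theorem bifFun_eq_sum_range (g : ℕ → E × F → E × F) (β : E → F) (s : ℕ) (α : E) :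
    bifFun g β s α = ∑ l ∈ Finset.range (s + 1), bellSum (fun b => (g (s - l) (α, b)).1) (β α) l l
      (fun j : Fin l => gam g β ((j : ℕ) + 1) α) := by
  rw [bifFun, Finset.range_eq_Ico, Finset.sum_eq_sum_Ico_succ_bot (Nat.succ_pos s),
    bellSum_zero_zero]
  rfl

/-- Expansion of the bifurcation equation at a fixed parameter. -/
theorem bifurcation_expansion [CompleteSpace E] [CompleteSpace F] {k : ℕ}
    {g : ℕ → E × F → E × F} {β : E → F} {α : E}
    (hg : ∀ i ≤ k, ContDiffAt ℝ (k + 1 : ℕ) (g i) (α, β α))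
    (hΔ : (Delta (g 0) β α).IsInvertible) {v : ℕ → F} (hv : v 0 = β α) {b : ℝ → F}
    (hb : (fun ε : ℝ => b ε - ∑ i ∈ Finset.range (k + 1), ε ^ i • v i)
      =O[𝓝 0] fun ε : ℝ => ε ^ (k + 1)) {u : ℝ → E × F}
    (hu : (fun ε : ℝ => u ε - ∑ i ∈ Finset.range (k + 1), ε ^ i • g i (α, b ε))
      =O[𝓝 0] fun ε : ℝ => ε ^ (k + 1))
    (hu2 : ∀ᶠ ε in 𝓝 0, (u ε).2 = 0) :
    (fun ε : ℝ => (u ε).1 - ∑ s ∈ Finset.range (k + 1), ε ^ s • bifFun g β s α)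
      =O[𝓝 0] fun ε : ℝ => ε ^ (k + 1) := by
  have hpair : ContDiff ℝ (k + 1 : ℕ) fun b : F => (α, b) := by fun_prop
  have hg' : ∀ i ≤ k, ContDiffAt ℝ (k + 1 : ℕ) (fun b => g i (α, b)) (v 0) := fun i hi =>
    ContDiffAt.comp (v 0) (hv ▸ hg i hi) hpair.contDiffAt
  have h1 := sum_comp_expansion (h := fun i b => (g i (α, b)).1)
    (fun i hi => (hg' i hi).fst) hb
  have h2 := sum_comp_expansion (h := fun i b => (g i (α, b)).2)
    (fun i hi => (hg' i hi).snd) hb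
  have hu1' := (ContinuousLinearMap.fst ℝ E F).isBigO_comp (fun ε : ℝ =>
    u ε - ∑ i ∈ Finset.range (k + 1), ε ^ i • g i (α, b ε)) (𝓝 0) |>.trans hu
  have hu2' := (ContinuousLinearMap.snd ℝ E F).isBigO_comp (fun ε : ℝ =>
    u ε - ∑ i ∈ Finset.range (k + 1), ε ^ i • g i (α, b ε)) (𝓝 0) |>.trans hu
  simp only [map_sub, map_sum, map_smul, ContinuousLinearMap.coe_fst',
    ContinuousLinearMap.coe_snd'] at hu1' hu2'
  have h3 := (hu2'.add h2).congr' (f₂ := fun ε : ℝ => - ∑ s ∈ Finset.range (k + 1), ε ^ s •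
    ∑ l ∈ Finset.range (s + 1), bellSum (fun b => (g (s - l) (α, b)).2) (v 0) l l
      fun j : Fin l => (((j : ℕ) + 1).factorial : ℝ) • v (j + 1))
    (by filter_upwards [hu2] with ε hε; rw [hε]; abel) (EventuallyEq.refl _ _)
  -- The `π^⊥` component is identically zero near `ε = 0`, so each of its coefficients vanishes.
  have h4 := eq_zero_of_sum_pow_smul_isBigO _ _
    ((isBigO_neg_left.1 h3).mono nhdsWithin_le_nhds)
  rw [hv] at h4 hg' h1
  have h5 := gam_eq_of_sum_bellSum_eq_zero (hg' 0 (Nat.zero_le k)).snd hΔ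
    fun s hs => h4 s (Nat.lt_succ_of_le hs)
  refine (hu1'.add h1).congr_left fun ε => ?_
  have h6 : ∀ s ∈ Finset.range (k + 1), ε ^ s • ∑ l ∈ Finset.range (s + 1),
      bellSum (fun b => (g (s - l) (α, b)).1) (β α) l l
        (fun j : Fin l => (((j : ℕ) + 1).factorial : ℝ) • v (j + 1)) =
      ε ^ s • bifFun g β s α := by
    intro s hs
    rw [bifFun_eq_sum_range]
    congr 1
    refine Finset.sum_congr rfl fun l hl => ?_
    rw [Finset.mem_range] at hs hl
    congr 1
    exact funext fun j => (h5 j (by omega)).symm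
  rw [Finset.sum_congr rfl h6]
  abel

end FixedParameter
-- The two implicit function arguments.
section Branch

universe w

theorem isInvertible_of_det_ne_zero {F : Type*} [NormedAddCommGroup F] [NormedSpace ℝ F]
    [FiniteDimensional ℝ F] {T : F →L[ℝ] F} (hT : T.det ≠ 0) : T.IsInvertible :=
  ⟨T.toContinuousLinearEquivOfDetNeZero hT, T.coe_toContinuousLinearEquivOfDetNeZero hT⟩

/-- An asymptotic expansion with a remainder that is locally uniform in the parameter. -/
theorem exists_expansion_isBigO {X G : Type w} [NormedAddCommGroup X] [NormedSpace ℝ X]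
    [FiniteDimensional ℝ X] [NormedAddCommGroup G] [NormedSpace ℝ G] [CompleteSpace G]
    {u : X × ℝ → G} {x : X} {j : ℕ} (hu : ContDiffAt ℝ j u (x, 0)) :
    ∃ a : ℕ → X → G, (fun p : X × ℝ => u p - ∑ i ∈ Finset.range j, p.2 ^ i • a i p.1)
      =O[𝓝 (x, 0)] fun p => p.2 ^ j := by
  -- All `j` derivatives are spent; the quotient is only continuous, hence locally bounded.
  obtain ⟨a, v, hv, h⟩ := exists_expansion j 0 (by simpa using hu)
  refine ⟨a, ?_⟩
  have h1 := (isBigO_refl (fun p : X × ℝ => p.2 ^ j) (𝓝 (x, 0))).smul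
    (hv.continuousAt.tendsto.isBigO_one ℝ)
  refine (h1.congr' (f₂ := fun p : X × ℝ => u p - ∑ i ∈ Finset.range j, p.2 ^ i • a i p.1)
    ?_ (by simp))
  filter_upwards [h] with p hp
  rw [hp]
  abel

/-- A locally uniform `O` at `(x, 0)` restricts to an `O` along nearby fibers. -/
theorem eventually_isBigO_fiber {X G : Type*} [TopologicalSpace X] [NormedAddCommGroup G]
    {u : X × ℝ → G} {x : X} {j : ℕ} (hu : u =O[𝓝 (x, 0)] fun p => p.2 ^ j) :
    ∀ᶠ y in 𝓝 x, (fun ε : ℝ => u (y, ε)) =O[𝓝 0] fun ε : ℝ => ε ^ j := by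
  obtain ⟨C, hC⟩ := hu.bound
  exact hC.curry_nhds.mono fun y hy => IsBigO.of_bound C hy

variable {E F : Type w} [NormedAddCommGroup E] [NormedSpace ℝ E] [FiniteDimensional ℝ E]
  [NormedAddCommGroup F] [NormedSpace ℝ F] [FiniteDimensional ℝ F]

/-- The solution `b(a, ε)` of `π^⊥ g(a, b, ε) = 0`. -/
theorem exists_implicit_branch {N : ℕ} (hN : N ≠ 0) {g : E × F → ℝ → E × F} {g₀ : E × F → E × F}
    {β : E → F} {α : E} (hg : ContDiffAt ℝ N (Function.uncurry g) ((α, β α), 0))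
    (hg₀ : ∀ᶠ z in 𝓝 (α, β α), g z 0 = g₀ z) (hβ : ContinuousAt β α)
    (hzero : ∀ᶠ a in 𝓝 α, g₀ (a, β a) = 0) (hΔ : (Delta g₀ β α).IsInvertible) :
    ∃ b : E × ℝ → F, ContDiffAt ℝ N b (α, 0) ∧ (∀ᶠ a in 𝓝 α, b (a, 0) = β a) ∧
      ∀ᶠ p in 𝓝 (α, (0 : ℝ)), (g (p.1, b p) p.2).2 = 0 := by
  let Ψ : (E × ℝ) × F → F := fun q => (g (q.1.1, q.2) q.1.2).2
  have hmap : ContDiff ℝ N fun q : (E × ℝ) × F => ((q.1.1, q.2), q.1.2) := by fun_prop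
  have hΨ : ContDiffAt ℝ N Ψ ((α, 0), β α) :=
    (ContDiffAt.comp (g := Function.uncurry g) ((α, (0 : ℝ)), β α) hg hmap.contDiffAt).snd
  have hN' : (N : WithTop ℕ∞) ≠ 0 := by exact_mod_cast hN
  have hpb : Tendsto (fun b : F => (α, b)) (𝓝 (β α)) (𝓝 (α, β α)) :=
    (by fun_prop : Continuous fun b : F => (α, b)).tendsto _
  have hD : fderiv ℝ Ψ ((α, 0), β α) ∘L .inr ℝ (E × ℝ) F = Delta g₀ β α := by
    have h1 : HasFDerivAt (fun b : F => Ψ ((α, 0), b))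
        (fderiv ℝ Ψ ((α, 0), β α) ∘L .inr ℝ (E × ℝ) F) (β α) :=
      HasFDerivAt.comp (β α) (hΨ.differentiableAt hN').hasFDerivAt
        (hasFDerivAt_prodMk_right (α, (0 : ℝ)) (β α))
    rw [← h1.fderiv, Delta]
    refine Filter.EventuallyEq.fderiv_eq ?_
    filter_upwards [hpb.eventually hg₀] with b hb
    simp only [Ψ, hb]
  have hinv : (fderiv ℝ Ψ ((α, 0), β α) ∘L .inr ℝ (E × ℝ) F).IsInvertible := hD ▸ hΔ
  have hzβ : Tendsto (fun a => (a, β a)) (𝓝 α) (𝓝 (α, β α)) := tendsto_id.prodMk_nhds hβ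
  have hΨβ : ∀ᶠ a in 𝓝 α, Ψ ((a, 0), β a) = 0 := by
    filter_upwards [hzβ.eventually hg₀, hzero] with a ha ha'
    simp only [Ψ, ha, ha', Prod.snd_zero]
  have hΨ0 : Ψ ((α, 0), β α) = 0 := hΨβ.self_of_nhds
  refine ⟨hΨ.implicitFunction hN' hinv, hΨ.contDiffAt_implicitFunction hN' hinv, ?_, ?_⟩
  -- Local uniqueness in the implicit function theorem identifies `b (a, 0)` with `β a`; continuity
  -- of `β` suffices.
  · have h1 : Tendsto (fun a => ((a, (0 : ℝ)), β a)) (𝓝 α) (𝓝 ((α, 0), β α)) :=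
      (tendsto_id.prodMk_nhds tendsto_const_nhds).prodMk_nhds hβ
    filter_upwards [h1.eventually (hΨ.eventually_apply_eq_iff_implicitFunction hN' hinv), hΨβ]
      with a ha ha'
    exact ha.1 (ha'.trans hΨ0.symm)
  · filter_upwards [hΨ.eventually_apply_implicitFunction hN' hinv] with p hp
    exact hp.trans hΨ0

/-- The filter `𝓝 0` includes `ε = 0`, where the bound reads `0`. -/
theorem eq_coeff_zero_of_expansion {G : Type*} [NormedAddCommGroup G] [NormedSpace ℝ G] {d : ℕ}
    {u : ℝ → G} {a : ℕ → G}
    (h : (fun ε : ℝ => u ε - ∑ i ∈ Finset.range (d + 1), ε ^ i • a i)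
      =O[𝓝 0] fun ε : ℝ => ε ^ (d + 1)) : u 0 = a 0 := by
  obtain ⟨C, hC⟩ := h.bound
  have h1 := hC.self_of_nhds
  simpa [Finset.sum_range_succ', sub_eq_zero] using h1

theorem exists_branch {k : ℕ} {g : E × F → ℝ → E × F} {gi : ℕ → E × F → E × F} {β : E → F}
    {α : E} (hg : ContDiffAt ℝ (k + 1 : ℕ) (Function.uncurry g) ((α, β α), 0))
    (hgi : ∀ᶠ a in 𝓝 α, ∀ i ≤ k, ContDiffAt ℝ (k + 1 : ℕ) (gi i) (a, β a))
    (hexp : ∀ᶠ z in 𝓝 (α, β α),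
      (fun ε : ℝ => g z ε - ∑ i ∈ Finset.range (k + 1), ε ^ i • gi i z)
        =O[𝓝 0] fun ε : ℝ => ε ^ (k + 1))
    (hβ : ContinuousAt β α) (hzero : ∀ᶠ a in 𝓝 α, gi 0 (a, β a) = 0)
    (hΔ : ∀ᶠ a in 𝓝 α, (Delta (gi 0) β a).IsInvertible)
    (hf : ∀ i, 1 ≤ i → i < k → ∀ᶠ a in 𝓝 α, bifFun gi β i a = 0)
    (hk : bifFun gi β k α = 0) (hsimple : (fderiv ℝ (bifFun gi β k) α).IsInvertible) :
    ∃ z : ℝ → E × F, ContDiffAt ℝ 1 z 0 ∧ z 0 = (α, β α) ∧ ∀ᶠ ε in 𝓝 0, g (z ε) ε = 0 := by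
  obtain ⟨b, hb, hb0, hbz⟩ := exists_implicit_branch (Nat.succ_ne_zero k) hg
    (hexp.mono fun z hz => eq_coeff_zero_of_expansion hz) hβ hzero hΔ.self_of_nhds
  have hbα : b (α, 0) = β α := hb0.self_of_nhds
  -- the expansion of `g` is locally uniform
  obtain ⟨a, ha⟩ := exists_expansion_isBigO hg
  -- The constants in `hexp` may depend on `z`. Fibrewise uniqueness identifies its coefficients
  -- with those of the uniform expansion, so the moving point `(a, b (a, ε))` can be substituted.
  have ha' : ∀ᶠ z in 𝓝 (α, β α), ∀ i < k + 1, a i z = gi i z := by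
    filter_upwards [eventually_isBigO_fiber ha, hexp] with z hz hz'
    exact expansion_unique (hz.mono nhdsWithin_le_nhds) (hz'.mono nhdsWithin_le_nhds)
  have hG : (fun q : (E × F) × ℝ => g q.1 q.2 - ∑ i ∈ Finset.range (k + 1), q.2 ^ i • gi i q.1)
      =O[𝓝 ((α, β α), 0)] fun q => q.2 ^ (k + 1) := by
    refine ha.congr' ?_ (EventuallyEq.refl _ _)
    filter_upwards [(continuous_fst.tendsto ((α, β α), (0 : ℝ))).eventually ha'] with q hq
    rw [Finset.sum_congr rfl fun i hi => by rw [hq i (Finset.mem_range.1 hi)]]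
    rfl
  have hm : ContDiffAt ℝ (k + 1 : ℕ) (fun p : E × ℝ => ((p.1, b p), p.2)) (α, 0) :=
    (contDiffAt_fst.prodMk hb).prodMk contDiffAt_snd
  have hmt : Tendsto (fun p : E × ℝ => ((p.1, b p), p.2)) (𝓝 (α, 0)) (𝓝 ((α, β α), 0)) := by
    simpa only [hbα] using hm.continuousAt.tendsto
  have hGm : (fun p : E × ℝ => g (p.1, b p) p.2 -
      ∑ i ∈ Finset.range (k + 1), p.2 ^ i • gi i (p.1, b p))
      =O[𝓝 (α, 0)] fun p => p.2 ^ (k + 1) := hG.comp_tendsto hmt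
  have hGb := eventually_isBigO_fiber hGm
  -- the expansion of the implicit branch
  obtain ⟨v, hv⟩ := exists_expansion_isBigO hb
  have hvb := eventually_isBigO_fiber hv
  -- the expansion of the reduced equation
  let δ : E × ℝ → E := fun p => (g (p.1, b p) p.2).1
  have hδ : ContDiffAt ℝ (1 + k : ℕ) δ (α, 0) := by
    rw [add_comm]
    refine ContDiffAt.fst (f := fun p : E × ℝ => g (p.1, b p) p.2) ?_
    exact ContDiffAt.comp (g := Function.uncurry g) (α, (0 : ℝ)) (by rwa [hbα]) hm
  -- After `k` divisions of a `C^{k+1}` function, `w` is still `C^1`, as the second implicit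
  -- function theorem needs.
  obtain ⟨d, w, hw, hdw⟩ := exists_expansion k 1 hδ
  -- One further division exposes `w (y, 0)` as the coefficient of order `k`.
  obtain ⟨w', hw', hww⟩ := exists_eq_add_smul (n := 0) hw
  let e : ℕ → E → E := fun i y => if i = k then w (y, 0) else d i y
  have hδe : (fun p : E × ℝ => δ p - ∑ i ∈ Finset.range (k + 1), p.2 ^ i • e i p.1)
      =O[𝓝 (α, 0)] fun p => p.2 ^ (k + 1) := by
    have h1 := (isBigO_refl (fun p : E × ℝ => p.2 ^ (k + 1)) (𝓝 (α, 0))).smul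
      (hw'.continuousAt.tendsto.isBigO_one ℝ)
    refine h1.congr' ?_ (by simp)
    filter_upwards [hdw, hww] with p hp hp'
    have h2 : ∑ i ∈ Finset.range k, p.2 ^ i • e i p.1 = ∑ i ∈ Finset.range k, p.2 ^ i • d i p.1 :=
      Finset.sum_congr rfl fun i hi => by simp only [e, if_neg (Finset.mem_range.1 hi).ne]
    rw [Finset.sum_range_succ, h2, hp, hp', smul_add, smul_smul, pow_succ]
    simp only [e, if_true]
    abel
  have he : ∀ᶠ y in 𝓝 α, ∀ i < k + 1, e i y = bifFun gi β i y := by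
    filter_upwards [eventually_isBigO_fiber hδe, hGb, hvb, hgi, hΔ, hb0, hbz.curry_nhds]
      with y h1 h2 h3 h4 h5 h6 h7
    have h8 := bifurcation_expansion h4 h5 ((eq_coeff_zero_of_expansion h3).symm.trans h6) h3
      (u := fun ε => g (y, b (y, ε)) ε) h2 h7
    exact expansion_unique (h1.mono nhdsWithin_le_nhds) (h8.mono nhdsWithin_le_nhds)
  have hf' : ∀ᶠ y in 𝓝 α, ∀ i < k, bifFun gi β i y = 0 := by
    refine (eventually_all_finset (Finset.range k)).2 (fun i hi => ?_) |>.mono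
      fun y hy i hi => hy i (Finset.mem_range.2 hi)
    rcases Nat.eq_zero_or_pos i with rfl | hi0
    · filter_upwards [hzero] with y hy
      simp [bifFun, hy]
    · exact hf i hi0 (Finset.mem_range.1 hi)
  have hδw : ∀ᶠ p in 𝓝 (α, (0 : ℝ)), δ p = p.2 ^ k • w p := by
    have h1 := (continuous_fst.tendsto (α, (0 : ℝ))).eventually (he.and hf')
    filter_upwards [hdw, h1] with p hp hp'
    rw [hp, Finset.sum_eq_zero, zero_add]
    intro i hi
    have hi := Finset.mem_range.1 hi
    have h2 := hp'.1 i (by omega)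
    rw [hp'.2 i hi] at h2
    simp only [e, if_neg hi.ne] at h2
    rw [h2, smul_zero]
  -- Equality near `α`, not just at `α`, also transfers the derivative of `f_k` to `w`.
  have hwf : (fun y => w (y, 0)) =ᶠ[𝓝 α] bifFun gi β k := by
    filter_upwards [he] with y hy
    simpa [e] using hy k (by omega)
  -- solving the reduced equation
  let φ : ℝ × E → E := fun q => w (q.2, q.1)
  have hφ : ContDiffAt ℝ (1 : ℕ) φ (0, α) :=
    ContDiffAt.comp (g := w) ((0 : ℝ), α) hw (contDiffAt_snd.prodMk contDiffAt_fst)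
  have hφ0 : φ (0, α) = 0 := hwf.self_of_nhds.trans hk
  have h1 : ((1 : ℕ) : WithTop ℕ∞) ≠ 0 := by simp
  have hinv : (fderiv ℝ φ (0, α) ∘L .inr ℝ ℝ E).IsInvertible := by
    have h2 : HasFDerivAt (fun y : E => φ (0, y)) (fderiv ℝ φ (0, α) ∘L .inr ℝ ℝ E) α :=
      HasFDerivAt.comp α (hφ.differentiableAt h1).hasFDerivAt
        (hasFDerivAt_prodMk_right (0 : ℝ) α)
    rw [← h2.fderiv]
    exact hwf.fderiv_eq (𝕜 := ℝ) ▸ hsimple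
  set A := hφ.implicitFunction h1 hinv
  have hA : ContDiffAt ℝ (1 : ℕ) A 0 := hφ.contDiffAt_implicitFunction h1 hinv
  have hA0 : A 0 = α := hφ.implicitFunction_apply_self h1 hinv
  have hAz : ∀ᶠ ε in 𝓝 0, w (A ε, ε) = 0 :=
    (hφ.eventually_apply_implicitFunction h1 hinv).mono fun ε hε => hε.trans hφ0
  have hAt : Tendsto (fun ε => (A ε, ε)) (𝓝 0) (𝓝 (α, 0)) := by
    have h2 : ContinuousAt (fun ε => (A ε, ε)) 0 := hA.continuousAt.prodMk continuousAt_id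
    simpa only [ContinuousAt, hA0] using h2
  refine ⟨fun ε => (A ε, b (A ε, ε)), ?_, by simp only [hA0, hbα], ?_⟩
  · refine hA.prodMk (ContDiffAt.comp (g := b) (0 : ℝ) ?_ (hA.prodMk contDiffAt_id))
    rw [hA0]
    exact hb.of_le (by exact_mod_cast Nat.le_add_left 1 k)
  · filter_upwards [hAz, hAt.eventually hδw, hAt.eventually hbz] with ε h2 h3 h4
    refine Prod.ext ?_ h4
    rw [h2, smul_zero] at h3
    exact h3

end Branch
end LyapunovSchmidt

/-! ### The main theorem, from the local branch. -/

theorem mainTheorem3 {m n k : ℕ} (hmn : m < n) (hk : 1 ≤ k)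
    -- the domain of the functions, a subset of `ℝ^m × ℝ^(n-m)`
    (D : Set (EuclideanSpace ℝ (Fin m) × EuclideanSpace ℝ (Fin (n - m))))
    (hD : IsOpen D) (hDb : Bornology.IsBounded D)
    -- `g(z,ε) = ∑ ε^i g_i(z) + O(ε^(k+1))`
    (gi : ℕ → EuclideanSpace ℝ (Fin m) × EuclideanSpace ℝ (Fin (n - m)) →
      EuclideanSpace ℝ (Fin m) × EuclideanSpace ℝ (Fin (n - m)))
    (hgi : ∀ i ≤ k, ContDiffOn ℝ ((k + 1 : ℕ) : WithTop ℕ∞) (gi i) D)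
    (ε₀ : ℝ) (hε₀ : 0 < ε₀)
    (g : EuclideanSpace ℝ (Fin m) × EuclideanSpace ℝ (Fin (n - m)) → ℝ →
      EuclideanSpace ℝ (Fin m) × EuclideanSpace ℝ (Fin (n - m)))
    (hg : ContDiffOn ℝ ((k + 1 : ℕ) : WithTop ℕ∞) (Function.uncurry g) (D ×ˢ Ioo (-ε₀) ε₀))
    (hexp : ∀ z ∈ D, (fun ε : ℝ => g z ε - ∑ i ∈ Finset.range (k + 1), ε ^ i • gi i z)
      =O[𝓝 0] fun ε : ℝ => ε ^ (k + 1))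
    -- the graph of `β` over the closure of `V`
    (V : Set (EuclideanSpace ℝ (Fin m))) (hV : IsOpen V) (hVb : Bornology.IsBounded V)
    (β : EuclideanSpace ℝ (Fin m) → EuclideanSpace ℝ (Fin (n - m)))
    (hβ : ContDiffOn ℝ ((k + 1 : ℕ) : WithTop ℕ∞) β (closure V))
    (hZ : ∀ α ∈ closure V, (α, β α) ∈ D)
    -- hypothesis (H_a)
    (hHa : ∀ α ∈ closure V, gi 0 (α, β α) = 0)
    (hΔ : ∀ α ∈ closure V, (LyapunovSchmidt.Delta (gi 0) β α).det ≠ 0)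
    (hf : ∀ i, 1 ≤ i → i < k → ∀ α ∈ closure V, LyapunovSchmidt.bifFun gi β i α = 0)
    (αs : EuclideanSpace ℝ (Fin m)) (hαs : αs ∈ V)
    (hzero : LyapunovSchmidt.bifFun gi β k αs = 0)
    (hsimple : (fderiv ℝ (LyapunovSchmidt.bifFun gi β k) αs).det ≠ 0) :
    -- a continuous branch of zeros emanating from `(αs, β αs)`
    ∃ ε₁ : ℝ, 0 < ε₁ ∧ ε₁ ≤ ε₀ ∧
      ∃ z : ℝ → EuclideanSpace ℝ (Fin m) × EuclideanSpace ℝ (Fin (n - m)),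
        ContinuousOn z (Ioo (-ε₁) ε₁) ∧
        (∀ ε ∈ Ioo (-ε₁) ε₁, z ε ∈ D ∧ g (z ε) ε = 0) ∧
        (fun ε : ℝ => ‖z ε - (αs, β αs)‖) =O[𝓝 0] fun ε : ℝ => ε := by
  have hV' : V ∈ 𝓝 αs := hV.mem_nhds hαs
  have hVc : ∀ᶠ a in 𝓝 αs, a ∈ closure V := Filter.mem_of_superset hV' subset_closure
  have hαc : αs ∈ closure V := subset_closure hαs
  have hzD : (αs, β αs) ∈ D := hZ αs hαc
  have hgα : ContDiffAt ℝ (k + 1 : ℕ) (Function.uncurry g) ((αs, β αs), 0) :=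
    hg.contDiffAt ((hD.prod isOpen_Ioo).mem_nhds ⟨hzD, by simpa using hε₀⟩)
  obtain ⟨z, hz, hz0, hgz⟩ := LyapunovSchmidt.exists_branch hgα
    (hVc.mono fun a ha i hi => (hgi i hi).contDiffAt (hD.mem_nhds (hZ a ha)))
    (Filter.mem_of_superset (hD.mem_nhds hzD) hexp)
    (hβ.continuousOn.continuousAt hVc) (hVc.mono hHa)
    (hVc.mono fun a ha => LyapunovSchmidt.isInvertible_of_det_ne_zero (hΔ a ha))
    (fun i h1 h2 => hVc.mono (hf i h1 h2)) hzero
    (LyapunovSchmidt.isInvertible_of_det_ne_zero hsimple)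
  -- Being `C^1` at `0` is an open condition, so it gives continuity on an interval.
  have hzc : ∀ᶠ ε in 𝓝 0, ContinuousAt z ε :=
    (hz.eventually (by simp)).mono fun _ h => h.continuousAt
  have hzDe : ∀ᶠ ε in 𝓝 0, z ε ∈ D :=
    hz.continuousAt.eventually (by rw [hz0]; exact hD.mem_nhds hzD)
  obtain ⟨r, hr, hball⟩ := Metric.eventually_nhds_iff_ball.1 (hzc.and (hzDe.and hgz))
  have hIoo : ∀ ε ∈ Ioo (-min r ε₀) (min r ε₀), ε ∈ Metric.ball (0 : ℝ) r := by
    intro ε hε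
    rw [mem_ball_zero_iff, Real.norm_eq_abs]
    exact (abs_lt.2 hε).trans_le (min_le_left _ _)
  refine ⟨min r ε₀, lt_min hr hε₀, min_le_right _ _, z,
    fun ε hε => (hball ε (hIoo ε hε)).1.continuousWithinAt,
    fun ε hε => (hball ε (hIoo ε hε)).2, ?_⟩
  simpa [hz0] using (hz.differentiableAt (by simp)).isBigO_sub.norm_left
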